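/- Let $\mathcal H$ and $\mathcal G$ be real Hilbert spaces. For a real Hilbert space $\mathcal K$, let $\Gamma_0(\mathcal K)$ be the class of lower semicontinuous convex functions $f\colon\mathcal K\to\left]-\infty,+\infty\right]$ such that $\operatorname{dom} f=\{x\in\mathcal K : f(x)<+\infty\}\neq\varnothing$. For a function $f\colon\mathcal K\to\left]-\infty,+\infty\right]$, the conjugate is $f^*\colon u\mapsto\sup_{x\in\mathcal K}(\langle x,u\rangle-f(x))$ and the subdifferential is the set-valued operator $\partial f\colon x\mapsto\{u\in\mathcal K : (\forall y\in\mathcal K)\ \langle y-x,u\rangle+f(x)\le f(y)\}$. The strong relative interior $\operatorname{sri} C$ of a convex set $C\subset\mathcal K$ is the set of points $x\in C$ such that the cone $\bigcup_{\lambda>0}\lambda(-x+C)$ generated by $-x+C$ is a closed vector subspace of $\mathcal K$. Let $L\colon\mathcal H\to\mathcal G$ be a bounded linear operator with adjoint $L^*$. For functions, the infimal postcomposition of $f\colon\mathcal H\to[-\infty,+\infty]$ by $L$ is $L\triangleright f\colon\mathcal G\to[-\infty,+\infty]\colon y\mapsto\inf_{x\in\mathcal H,\,Lx=y}f(x)$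 (with $\inf\varnothing=+\infty$), and the infimal convolution of $f_1,f_2\colon\mathcal G\to\left]-\infty,+\infty\right]$ is $f_1\,\square\,f_2\colon x\mapsto\inf_{y\in\mathcal G}(f_1(x-y)+f_2(y))$. For set-valued operators, $A^{-1}u=\{x : u\in Ax\}$, the parallel composition of $A\colon\mathcal H\to2^{\mathcal H}$ by $L$ is $L\triangleright A=(L\circ A^{-1}\circ L^*)^{-1}\colon\mathcal G\to2^{\mathcal G}$, and the parallel sum of $A,B\colon\mathcal G\to2^{\mathcal G}$ is $A\,\square\,B=(A^{-1}+B^{-1})^{-1}$. Let $f\in\Gamma_0(\mathcal H)$ and $g\in\Gamma_0(\mathcal G)$, and suppose that $$0\in\operatorname{sri}\big(L^*(\operatorname{dom} g^*)-\operatorname{dom} f^*\big).$$ Then the following hold. (i) $(L\triangleright f)\,\square\,g\in\Gamma_0(\mathcal G)$. (ii) $\partial\big((L\triangleright f)\,\square\,g\big)=(L\triangleright\partial f)\,\square\,\partial g$. -/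

import Mathlib

open scoped Pointwise

noncomputable section

variable {H G : Type*}
  [NormedAddCommGroup H] [InnerProductSpace ℝ H]
  [NormedAddCommGroup G] [InnerProductSpace ℝ G]

/-- The domain `{x | f x < +∞}` of an extended-real-valued function. -/
def effDom (f : H → EReal) : Set H := {x | f x < ⊤}

/-- The epigraph of `f`, a subset of `H × ℝ`. -/
def epigraphSet (f : H → EReal) : Set (H × ℝ) := {p | f p.1 ≤ (p.2 : EReal)}

variable (H) in
/-- The class `Γ₀(H)` of lower semicontinuous convex functions `f : H → ]-∞, +∞]` with nonempty
domain.  Convexity of `f` is convexity of its epigraph. -/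
def Gamma0 : Set (H → EReal) :=
  {f | LowerSemicontinuous f ∧ Convex ℝ (epigraphSet f) ∧ (∀ x, f x ≠ ⊥) ∧ (effDom f).Nonempty}

/-- The conjugate `f* : u ↦ sup_x (⟨x, u⟩ - f x)`. -/
def fenchelConj (f : H → EReal) : H → EReal :=
  fun u => ⨆ x : H, ((inner ℝ x u : ℝ) : EReal) - f x

/-- The subdifferential `∂f`, a set-valued operator on `H`. -/
def subdiff (f : H → EReal) : H → Set H :=
  fun x => {u | ∀ y : H, ((inner ℝ (y - x) u : ℝ) : EReal) + f x ≤ f y}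

/-- The infimal convolution of `f₁` and `f₂`: `x ↦ inf_y (f₁ (x - y) + f₂ y)`.  It is meant for
functions that do not take the value `-∞`. -/
def infConv (f₁ f₂ : H → EReal) : H → EReal :=
  fun x => ⨅ y : H, f₁ (x - y) + f₂ y

/-- The infimal postcomposition of `f` by `L`: `y ↦ inf f (L⁻¹ {y})`; the infimum of the empty
set is `+∞`. -/
def infPostcomp (L : H → G) (f : H → EReal) : G → EReal :=
  fun y => sInf (f '' (L ⁻¹' {y}))

/-- The cone `⋃_{c > 0} c C` generated by a set `C`. -/
def coneGen (C : Set H) : Set H := {z | ∃ c : ℝ, 0 < c ∧ ∃ x ∈ C, z = c • x}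

/-- The strong relative interior of a (convex) set `C`: the points `x ∈ C` such that the cone
generated by `-x + C` is a closed vector subspace. -/
def strongRelInterior (C : Set H) : Set H :=
  {x | x ∈ C ∧ ∃ V : Submodule ℝ H, IsClosed (V : Set H) ∧
    coneGen ((fun y => -x + y) '' C) = (V : Set H)}

/-- The inverse of a set-valued operator. -/
def opInv (A : H → Set G) : G → Set H := fun u => {x | u ∈ A x}

/-- The parallel sum `(A⁻¹ + B⁻¹)⁻¹` of two set-valued operators; the sum of two operators is
the pointwise Minkowski sum. -/
def parallelSum (A B : H → Set H) : H → Set H :=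
  opInv (fun u => opInv A u + opInv B u)

/-- The parallel composition `(L ∘ A⁻¹ ∘ L*)⁻¹` of the set-valued operator `A` by `L`. -/
def parallelComp [CompleteSpace H] [CompleteSpace G] (L : H →L[ℝ] G) (A : H → Set H) :
    G → Set G :=
  opInv (fun v => L '' (opInv A (ContinuousLinearMap.adjoint L v)))

end

/-! At `z` the convolution is the infimum over `x` of `f x + g (z - L x)`, and everything rests on a
closedness property of this marginal problem (`exists_limit_add_le`). Let `f x_n + g (z_n - L x_n) ≤
a_n` with `z_n` and `a_n` convergent. Affine minorants of `f` and `g` with slopes `u` and `v` bound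
`⟨x_n, u - L* v⟩` above. By the qualification condition, multiples of such differences fill a closed
subspace `V`, so Banach–Steinhaus and weak compactness give a limit point `x₀` tested on `V`. The
inequality passes to the limit for each pair of minorants, and Fenchel–Moreau recovers it for `f`
and `g` at `x₀`.

Constant `z_n` gives attainment of the infimum, convergent `z_n` lower semicontinuity. Given a
minimizer, the subdifferential formula follows by varying one summand at a time. -/

open Filter Topology

/-- `y ↦ ⟨y, u⟩ - c` is a continuous affine minorant of `f`. -/
def IsAffineMinorant {K : Type*} [NormedAddCommGroup K] [InnerProductSpace ℝ K]
    (f : K → EReal) (u : K) (c : ℝ) : Prop :=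
  ∀ y, ((inner ℝ y u - c : ℝ) : EReal) ≤ f y

/-! ### Affine minorants and the Fenchel–Moreau theorem -/

section FenchelMoreau

variable {K : Type*} [NormedAddCommGroup K] [InnerProductSpace ℝ K] {f : K → EReal}

theorem IsAffineMinorant.le_real {u : K} {c : ℝ} (h : IsAffineMinorant f u c) {x : K} {s : ℝ}
    (hs : f x ≤ s) : inner ℝ x u - c ≤ s :=
  EReal.coe_le_coe_iff.1 ((h x).trans hs)

theorem IsAffineMinorant.ne_bot {u : K} {c : ℝ} (h : IsAffineMinorant f u c) (x : K) :
    f x ≠ ⊥ :=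
  ((EReal.bot_lt_coe _).trans_le (h x)).ne'

/-- Together with `IsAffineMinorant.mem_effDom_fenchelConj`, this translates the qualification
condition into slopes of affine minorants. -/
theorem exists_isAffineMinorant_of_mem_effDom_fenchelConj (hbot : ∀ x, f x ≠ ⊥) {u : K}
    (hu : u ∈ effDom (fenchelConj f)) : ∃ c, IsAffineMinorant f u c := by
  obtain ⟨c, hc, -⟩ := EReal.lt_iff_exists_real_btwn.1 (show fenchelConj f u < ⊤ from hu)
  refine ⟨c, fun y => ?_⟩
  have h := (le_iSup (fun x : K => ((inner ℝ x u : ℝ) : EReal) - f x) y).trans hc.le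
  have hb := hbot y
  revert h hb
  induction f y with
  | bot => simp
  | top => simp
  | coe t =>
    intro h _
    norm_cast at h ⊢
    linarith

theorem IsAffineMinorant.mem_effDom_fenchelConj {u : K} {c : ℝ} (h : IsAffineMinorant f u c) :
    u ∈ effDom (fenchelConj f) := by
  refine lt_of_le_of_lt (iSup_le fun y => ?_) (EReal.coe_lt_top c)
  have hy := h y
  have hb := h.ne_bot y
  revert hy hb
  induction f y with
  | bot => simp
  | top => simp
  | coe t =>
    intro h _
    norm_cast at h ⊢
    linarith

omit [InnerProductSpace ℝ K] in
theorem isClosed_epigraphSet (hf : LowerSemicontinuous f) : IsClosed (epigraphSet f) :=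
  hf.isClosed_epigraph.preimage
    (continuous_fst.prodMk (continuous_coe_real_ereal.comp continuous_snd))

/-- Separation of a point below the graph of `f` from the epigraph of `f`. -/
theorem exists_separating_epigraphSet [CompleteSpace K] (hf : f ∈ Gamma0 K) {x : K} {r : ℝ}
    (hr : (r : EReal) < f x) :
    ∃ (w : K) (β γ : ℝ), 0 ≤ β ∧ inner ℝ x w + r * β < γ ∧
      ∀ (y : K) (t : ℝ), f y ≤ t → γ < inner ℝ y w + t * β := by
  obtain ⟨hlsc, hconv, hbot, x₀, hx₀⟩ := hf
  obtain ⟨ℓ, γ, h1, h2⟩ := geometric_hahn_banach_point_closed (x := (x, r)) hconv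
    (isClosed_epigraphSet hlsc) (by simpa [epigraphSet] using hr)
  have hℓ : ∀ (y : K) (t : ℝ), ℓ (y, t) =
      inner ℝ y ((InnerProductSpace.toDual ℝ K).symm (ℓ.comp (.inl ℝ K ℝ))) + t * ℓ (0, 1) := by
    intro y t
    rw [real_inner_comm, InnerProductSpace.toDual_symm_apply]
    have : (y, t) = (y, (0 : ℝ)) + t • ((0 : K), (1 : ℝ)) := by simp
    rw [this, map_add, map_smul]
    simp
  have hsep : ∀ (y : K) (t : ℝ), f y ≤ t → γ < inner ℝ y
      ((InnerProductSpace.toDual ℝ K).symm (ℓ.comp (.inl ℝ K ℝ))) + t * ℓ (0, 1) :=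
    fun y t h => hℓ y t ▸ h2 (y, t) h
  refine ⟨_, ℓ (0, 1), γ, ?_, hℓ x r ▸ h1, hsep⟩
  by_contra! hneg
  obtain ⟨t₀, ht₀, -⟩ := EReal.lt_iff_exists_real_btwn.1 hx₀
  have h0 := hsep x₀ t₀ ht₀.le
  set q := inner ℝ x₀ ((InnerProductSpace.toDual ℝ K).symm (ℓ.comp (.inl ℝ K ℝ)))
  set β := ℓ (0, 1)
  have h3 := hsep x₀ (t₀ + (q + t₀ * β - γ) / (-β))
    (ht₀.le.trans (EReal.coe_le_coe_iff.2 (le_add_of_nonneg_right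
      (div_nonneg (by linarith) (by linarith)))))
  -- For `β < 0`, this upward shift inside the epigraph lowers the functional to exactly `γ`,
  -- against strict separation.
  have h4 : (t₀ + (q + t₀ * β - γ) / (-β)) * β = t₀ * β - (q + t₀ * β - γ) := by
    have := hneg.ne
    field_simp
    ring
  rw [h4] at h3
  linarith

/-- A non-vertical hyperplane is the graph of an affine function: solve for the height by dividing
by `β`. -/
theorem exists_isAffineMinorant_of_separating (hbot : ∀ x, f x ≠ ⊥) {x w : K} {r β γ : ℝ}
    (hβ : 0 < β)
    (h1 : inner ℝ x w + r * β < γ)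
    (h2 : ∀ (y : K) (t : ℝ), f y ≤ t → γ < inner ℝ y w + t * β) :
    ∃ u c, IsAffineMinorant f u c ∧ r < inner ℝ x u - c := by
  refine ⟨-(β⁻¹ • w), -(γ / β), fun y => ?_, ?_⟩
  · have hb := hbot y
    have h := h2 y
    revert hb h
    induction f y with
    | bot => simp
    | top => simp
    | coe t =>
      intro _ h
      have := h t le_rfl
      rw [EReal.coe_le_coe_iff, inner_neg_right, inner_smul_right]
      have e : -(β⁻¹ * inner ℝ y w) - -(γ / β) = (γ - inner ℝ y w) / β := by
        field_simp; ring
      rw [e, div_le_iff₀ hβ]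
      linarith
  · rw [inner_neg_right, inner_smul_right]
    have e : -(β⁻¹ * inner ℝ x w) - -(γ / β) = (γ - inner ℝ x w) / β := by
      field_simp; ring
    rw [e, lt_div_iff₀ hβ]
    linarith

variable [CompleteSpace K]

theorem exists_isAffineMinorant (hf : f ∈ Gamma0 K) : ∃ u c, IsAffineMinorant f u c := by
  obtain ⟨x, hx⟩ := hf.2.2.2
  obtain ⟨t, ht, -⟩ := EReal.lt_iff_exists_real_btwn.1 hx
  obtain ⟨r, -, hr⟩ := EReal.lt_iff_exists_real_btwn.1 (bot_lt_iff_ne_bot.2 (hf.2.2.1 x))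
  obtain ⟨w, β, γ, hβ, h1, h2⟩ := exists_separating_epigraphSet hf hr
  rcases hβ.eq_or_lt with rfl | hβ
  · have := h2 x t ht.le
    simp at h1 this
    linarith
  · obtain ⟨u, c, h, -⟩ := exists_isAffineMinorant_of_separating hf.2.2.1 hβ h1 h2
    exact ⟨u, c, h⟩

/-- The Fenchel–Moreau theorem: a function in `Γ₀(K)` is the supremum of its continuous affine
minorants. -/
theorem exists_isAffineMinorant_lt (hf : f ∈ Gamma0 K) {x : K} {r : ℝ} (hr : (r : EReal) < f x) :
    ∃ u c, IsAffineMinorant f u c ∧ r < inner ℝ x u - c := by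
  obtain ⟨w, β, γ, hβ, h1, h2⟩ := exists_separating_epigraphSet hf hr
  rcases hβ.eq_or_lt with rfl | hβ
  -- Vertical hyperplane: `γ - ⟨·, w⟩` is negative on the domain of `f` and positive at `x`, so
  -- adding a large multiple of it to any minorant keeps a minorant and exceeds `r` at `x`.
  · obtain ⟨u₀, c₀, h₀⟩ := exists_isAffineMinorant hf
    simp only [mul_zero, add_zero] at h1 h2
    obtain ⟨k, hk⟩ := exists_nat_gt ((r - (inner ℝ x u₀ - c₀)) / (γ - inner ℝ x w))
    rw [div_lt_iff₀ (by linarith)] at hk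
    refine ⟨u₀ - (k : ℝ) • w, c₀ - k * γ, fun y => ?_, ?_⟩
    · have hy := h₀ y
      have hb := h₀.ne_bot y
      have h := h2 y
      revert hy hb h
      induction f y with
      | bot => simp
      | top => simp
      | coe t =>
        intro hy _ h
        have := mul_le_mul_of_nonneg_left (h t le_rfl).le (Nat.cast_nonneg (α := ℝ) k)
        rw [EReal.coe_le_coe_iff] at hy ⊢
        rw [inner_sub_right, inner_smul_right]
        linarith
    · rw [inner_sub_right, inner_smul_right]
      linarith
  · exact exists_isAffineMinorant_of_separating hf.2.2.1 hβ h1 h2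

theorem le_coe_of_forall_isAffineMinorant (hf : f ∈ Gamma0 K) {x : K} {s : ℝ}
    (h : ∀ u c, IsAffineMinorant f u c → inner ℝ x u - c ≤ s) : f x ≤ s := by
  by_contra! hlt
  obtain ⟨u, c, hu, hs⟩ := exists_isAffineMinorant_lt hf hlt
  exact (h u c hu).not_gt hs

end FenchelMoreau

/-! ### Infimal convolution: weak limits, exactness and membership in `Γ₀` -/

section InfimalConvolution

variable {H G : Type*}
  [NormedAddCommGroup H] [InnerProductSpace ℝ H]
  [NormedAddCommGroup G] [InnerProductSpace ℝ G]
  {f : H → EReal} {g : G → EReal} {L : H →L[ℝ] G}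

theorem EReal.exists_real_add_le {a b : EReal} (ha : a ≠ ⊥) (hb : b ≠ ⊥) {r : ℝ}
    (h : a + b ≤ r) : ∃ s t : ℝ, a = s ∧ b = t ∧ s + t ≤ r := by
  revert ha hb h
  induction a with
  | bot => simp
  | top =>
    intro _ hb h
    rw [EReal.top_add_of_ne_bot hb] at h
    exact absurd h (EReal.coe_lt_top r).not_ge
  | coe s =>
    induction b with
    | bot => simp
    | top => simp
    | coe t =>
      intro _ _ h
      exact ⟨s, t, rfl, rfl, by exact_mod_cast h⟩

theorem infConv_infPostcomp_le (L : H →L[ℝ] G) (f : H → EReal) (g : G → EReal) (x : H) (z : G) :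
    infConv (infPostcomp L f) g z ≤ f x + g (z - L x) := by
  have hx : infPostcomp L f (z - (z - L x)) ≤ f x := sInf_le ⟨x, by simp, rfl⟩
  exact (iInf_le _ (z - L x)).trans (add_le_add_left hx _)

theorem IsAffineMinorant.infPostcomp [CompleteSpace H] [CompleteSpace G] {v : G} {c : ℝ}
    (h : IsAffineMinorant f (ContinuousLinearMap.adjoint L v) c) :
    IsAffineMinorant (infPostcomp L f) v c := by
  rintro y
  refine le_sInf ?_
  rintro _ ⟨x, rfl, rfl⟩
  simpa [ContinuousLinearMap.adjoint_inner_right] using h x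

theorem exists_add_lt_of_infConv_infPostcomp_lt (hf : ∀ y, infPostcomp L f y ≠ ⊥)
    (hg : ∀ y, g y ≠ ⊥) {z : G} {r : ℝ} (h : infConv (infPostcomp L f) g z < r) :
    ∃ x, f x + g (z - L x) < r := by
  obtain ⟨y, hy⟩ := iInf_lt_iff.1 h
  obtain ⟨s, t, -, ht, -⟩ := EReal.exists_real_add_le (hf _) (hg _) hy.le
  rw [ht, ← EReal.lt_sub_iff_add_lt (.inl (EReal.coe_ne_bot t)) (.inl (EReal.coe_ne_top t))] at hy
  obtain ⟨_, ⟨x, hx, rfl⟩, hlt⟩ := sInf_lt_iff.1 hy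
  refine ⟨x, ?_⟩
  rw [show L x = z - y from hx, sub_sub_cancel, ht]
  rwa [EReal.lt_sub_iff_add_lt (.inl (EReal.coe_ne_bot t)) (.inl (EReal.coe_ne_top t))] at hlt

/-- Weak sequential compactness in a Hilbert space, in ultrafilter form: a sequence which is
pointwise bounded on a closed subspace `V` has a weak limit along any ultrafilter, tested on `V`. -/
theorem exists_tendsto_inner_of_pointwise_bounded [CompleteSpace H] (V : Submodule ℝ H)
    (hV : IsClosed (V : Set H)) (x : ℕ → H)
    (hx : ∀ p ∈ V, ∃ C : ℝ, ∀ n, inner ℝ (x n) p ≤ C) (U : Ultrafilter ℕ) :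
    ∃ x₀ : H, ∀ p ∈ V, Tendsto (fun n => (inner ℝ (x n) p : ℝ)) U (𝓝 (inner ℝ x₀ p)) := by
  have : CompleteSpace V := hV.completeSpace_coe
  let T : ℕ → StrongDual ℝ V := fun n => (innerSL ℝ (x n)).comp V.subtypeL
  have hT : ∀ n (p : V), T n p = inner ℝ (x n) (p : H) := fun n p => rfl
  obtain ⟨C, hC⟩ := banach_steinhaus (g := T) fun p => by
    obtain ⟨C₁, h₁⟩ := hx p p.2
    obtain ⟨C₂, h₂⟩ := hx (-p) (V.neg_mem p.2)
    refine ⟨max C₁ C₂, fun n => ?_⟩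
    rw [hT, Real.norm_eq_abs, abs_le']
    have h := h₂ n
    rw [inner_neg_right] at h
    exact ⟨(h₁ n).trans (le_max_left _ _), h.trans (le_max_right _ _)⟩
  obtain ⟨ℓ, -, hℓ⟩ := (WeakDual.isCompact_closedBall (0 : StrongDual ℝ V) C).ultrafilter_le_nhds
    (U.map fun n => StrongDual.toWeakDual (T n)) (by
      refine Filter.le_principal_iff.2 (Filter.mem_map.2 (Filter.Eventually.of_forall fun n => ?_))
      simpa using hC n)
  refine ⟨((InnerProductSpace.toDual ℝ V).symm (WeakDual.toStrongDual ℓ) : V), fun p hp => ?_⟩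
  have h := ((WeakDual.eval_continuous (𝕜 := ℝ) (⟨p, hp⟩ : V)).tendsto ℓ).comp
    (show Tendsto (fun n => StrongDual.toWeakDual (T n)) U (𝓝 ℓ) from hℓ)
  have e : (inner ℝ (((InnerProductSpace.toDual ℝ V).symm (WeakDual.toStrongDual ℓ) : V) : H) p : ℝ)
      = ℓ ⟨p, hp⟩ :=
    InnerProductSpace.toDual_symm_apply (𝕜 := ℝ) (x := (⟨p, hp⟩ : V))
      (y := WeakDual.toStrongDual ℓ)
  rw [e]
  exact h

theorem mem_subdiff_iff_of_eq_coe {x u : H} {s : ℝ} (hx : f x = s) :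
    u ∈ subdiff f x ↔ ∀ (y : H) (r : ℝ), f y ≤ r → inner ℝ (y - x) u + s ≤ r := by
  simp only [subdiff, Set.mem_ofPred_eq, hx, ← EReal.coe_add]
  refine ⟨fun h y r hr => EReal.coe_le_coe_iff.1 ((h y).trans hr), fun h y => ?_⟩
  refine le_of_forall_gt fun c hc => ?_
  obtain ⟨r, hr, hrc⟩ := EReal.lt_iff_exists_real_btwn.1 hc
  exact lt_of_le_of_lt (EReal.coe_le_coe_iff.2 (h y r hr.le)) hrc

theorem exists_eq_coe_of_mem_subdiff (hbot : ∀ x, f x ≠ ⊥) (hdom : (effDom f).Nonempty) {x u : H}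
    (hu : u ∈ subdiff f x) : ∃ s : ℝ, f x = s := by
  refine ⟨_, (EReal.coe_toReal (fun htop => ?_) (hbot x)).symm⟩
  obtain ⟨y, hy⟩ := hdom
  have := hu y
  rw [htop, EReal.coe_add_top] at this
  exact absurd hy this.not_gt

variable [CompleteSpace H] [CompleteSpace G]

/-- Under the qualification condition, the sublevel sets of `(x, z) ↦ f x + g (z - L x)` project to
closed sets in `z`, in sequential form. -/
theorem exists_limit_add_le (hf : f ∈ Gamma0 H) (hg : g ∈ Gamma0 G)
    (hL : (0 : H) ∈ strongRelInterior
      (ContinuousLinearMap.adjoint L '' effDom (fenchelConj g) - effDom (fenchelConj f)))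
    {z : ℕ → G} {z₀ : G} (hz : Tendsto z atTop (𝓝 z₀)) {a : ℕ → ℝ} {a₀ : ℝ}
    (ha : Tendsto a atTop (𝓝 a₀)) {x : ℕ → H} (h : ∀ n, f (x n) + g (z n - L (x n)) ≤ a n) :
    ∃ x₀, f x₀ + g (z₀ - L x₀) ≤ a₀ := by
  obtain ⟨-, V, hVc, hV⟩ := hL
  simp only [neg_zero, zero_add, Set.image_id'] at hV
  have key : ∀ {u c v d}, IsAffineMinorant f u c → IsAffineMinorant g v d → ∀ n,
      inner ℝ (x n) (u - ContinuousLinearMap.adjoint L v) ≤ a n + c + d - inner ℝ (z n) v := by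
    intro u c v d hu hv n
    obtain ⟨s, t, hs, ht, hst⟩ := EReal.exists_real_add_le (hf.2.2.1 _) (hg.2.2.1 _) (h n)
    have h1 := hu.le_real hs.le
    have h2 := hv.le_real ht.le
    rw [inner_sub_left] at h2
    rw [inner_sub_right, ContinuousLinearMap.adjoint_inner_right]
    linarith
  have hbdd : ∀ p ∈ V, ∃ C : ℝ, ∀ n, inner ℝ (x n) p ≤ C := by
    intro p hp
    -- `V` is generated by the differences `L* v - u`, while `key` bounds the pairing with `u - L*
    -- v`; hence the sign change.
    have hp' : -p ∈ (V : Set H) := V.neg_mem hp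
    rw [← hV] at hp'
    obtain ⟨r, hr, _, ⟨_, ⟨v, hv, rfl⟩, u, hu, rfl⟩, hpr⟩ := hp'
    obtain ⟨c, hc⟩ := exists_isAffineMinorant_of_mem_effDom_fenchelConj hf.2.2.1 hu
    obtain ⟨d, hd⟩ := exists_isAffineMinorant_of_mem_effDom_fenchelConj hg.2.2.1 hv
    have hlim : Tendsto (fun n => a n + c + d - inner ℝ (z n) v) atTop
        (𝓝 (a₀ + c + d - inner ℝ z₀ v)) :=
      ((ha.add_const c).add_const d).sub (hz.inner tendsto_const_nhds)
    obtain ⟨B, hB⟩ := hlim.bddAbove_range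
    refine ⟨r * B, fun n => ?_⟩
    have e : p = r • (u - ContinuousLinearMap.adjoint L v) := by
      rw [← neg_neg p, hpr, ← smul_neg, neg_sub]
    rw [e, inner_smul_right]
    exact mul_le_mul_of_nonneg_left ((key hc hd n).trans (hB ⟨n, rfl⟩)) hr.le
  obtain ⟨x₀, hx₀⟩ := exists_tendsto_inner_of_pointwise_bounded V hVc x hbdd
    (Filter.hyperfilter ℕ)
  have hU : (Filter.hyperfilter ℕ : Filter ℕ) ≤ atTop :=
    Nat.cofinite_eq_atTop ▸ Filter.hyperfilter_le_cofinite
  have main : ∀ u c, IsAffineMinorant f u c → ∀ v d, IsAffineMinorant g v d →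
      (inner ℝ x₀ u - c) + (inner ℝ (z₀ - L x₀) v - d) ≤ a₀ := by
    intro u c hu v d hv
    have hmem : u - ContinuousLinearMap.adjoint L v ∈ V := by
      rw [← neg_sub, V.neg_mem_iff, ← SetLike.mem_coe, ← hV]
      exact ⟨1, one_pos, _, ⟨_, ⟨v, hv.mem_effDom_fenchelConj, rfl⟩, u,
        hu.mem_effDom_fenchelConj, rfl⟩, (one_smul _ _).symm⟩
    have := le_of_tendsto_of_tendsto' (hx₀ _ hmem)
      ((((ha.add_const c).add_const d).sub (hz.inner tendsto_const_nhds)).mono_left hU)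
      (key hu hv)
    rw [inner_sub_right, ContinuousLinearMap.adjoint_inner_right] at this
    rw [inner_sub_left]
    linarith
  -- One fixed minorant of `g` makes `f x₀` finite; the two suprema in `main` can then be taken
  -- successively.
  obtain ⟨v₁, d₁, hv₁⟩ := exists_isAffineMinorant hg
  have hfx : f x₀ ≤ ((a₀ - (inner ℝ (z₀ - L x₀) v₁ - d₁) : ℝ) : EReal) :=
    le_coe_of_forall_isAffineMinorant hf fun u c hu => by linarith [main u c hu v₁ d₁ hv₁]
  have hfs : f x₀ = ((f x₀).toReal : EReal) :=
    (EReal.coe_toReal (hfx.trans_lt (EReal.coe_lt_top _)).ne (hf.2.2.1 x₀)).symm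
  have hgx : g (z₀ - L x₀) ≤ ((a₀ - (f x₀).toReal : ℝ) : EReal) :=
    le_coe_of_forall_isAffineMinorant hg fun v d hv => by
      have : f x₀ ≤ ((a₀ - (inner ℝ (z₀ - L x₀) v - d) : ℝ) : EReal) :=
        le_coe_of_forall_isAffineMinorant hf fun u c hu => by linarith [main u c hu v d hv]
      rw [hfs, EReal.coe_le_coe_iff] at this
      linarith
  refine ⟨x₀, (add_le_add hfs.le hgx).trans ?_⟩
  rw [← EReal.coe_add, add_sub_cancel]

/-- Since `0` lies in the difference set itself, some `L* v` is also a slope for `f`. This keeps the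
convolution above an affine function, hence away from `-∞`. -/
theorem exists_common_isAffineMinorant (hf : ∀ x, f x ≠ ⊥) (hg : ∀ y, g y ≠ ⊥)
    (hL : (0 : H) ∈ strongRelInterior
      (ContinuousLinearMap.adjoint L '' effDom (fenchelConj g) - effDom (fenchelConj f))) :
    ∃ v c d, IsAffineMinorant f (ContinuousLinearMap.adjoint L v) c ∧ IsAffineMinorant g v d := by
  obtain ⟨⟨_, ⟨v, hv, rfl⟩, u, hu, huv⟩, -⟩ := hL
  obtain rfl : ContinuousLinearMap.adjoint L v = u := sub_eq_zero.1 huv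
  obtain ⟨c, hc⟩ := exists_isAffineMinorant_of_mem_effDom_fenchelConj hf hu
  obtain ⟨d, hd⟩ := exists_isAffineMinorant_of_mem_effDom_fenchelConj hg hv
  exact ⟨v, c, d, hc, hd⟩

/-- Exactness of `(L ▷ f) □ g` under the qualification condition. -/
theorem infConv_infPostcomp_le_coe_iff (hf : f ∈ Gamma0 H) (hg : g ∈ Gamma0 G)
    (hL : (0 : H) ∈ strongRelInterior
      (ContinuousLinearMap.adjoint L '' effDom (fenchelConj g) - effDom (fenchelConj f)))
    {z : G} {a : ℝ} :
    infConv (infPostcomp L f) g z ≤ a ↔ ∃ x, f x + g (z - L x) ≤ a := by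
  refine ⟨fun h => ?_, fun ⟨x, hx⟩ => (infConv_infPostcomp_le L f g x z).trans hx⟩
  obtain ⟨v, c, d, hc, hd⟩ := exists_common_isAffineMinorant hf.2.2.1 hg.2.2.1 hL
  have hex : ∀ n : ℕ, ∃ x, f x + g (z - L x) ≤ ((a + 1 / ((n : ℝ) + 1) : ℝ) : EReal) := fun n =>
    (exists_add_lt_of_infConv_infPostcomp_lt hc.infPostcomp.ne_bot hg.2.2.1 (h.trans_lt
      (EReal.coe_lt_coe_iff.2 (lt_add_of_pos_right a Nat.one_div_pos_of_nat)))).imp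
        fun _ => le_of_lt
  choose x hx using hex
  refine exists_limit_add_le hf hg hL tendsto_const_nhds ?_ hx
  simpa using tendsto_one_div_add_atTop_nhds_zero_nat.const_add a

theorem infConv_infPostcomp_ne_bot (hf : f ∈ Gamma0 H) (hg : g ∈ Gamma0 G)
    (hL : (0 : H) ∈ strongRelInterior
      (ContinuousLinearMap.adjoint L '' effDom (fenchelConj g) - effDom (fenchelConj f))) (z : G) :
    infConv (infPostcomp L f) g z ≠ ⊥ := by
  obtain ⟨v, c, d, hc, hd⟩ := exists_common_isAffineMinorant hf.2.2.1 hg.2.2.1 hL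
  refine IsAffineMinorant.ne_bot (f := infConv (infPostcomp L f) g) (u := v) (c := c + d)
    (fun z' => le_iInf fun y => ?_) z
  refine le_trans ?_ (add_le_add (hc.infPostcomp (z' - y)) (hd y))
  rw [← EReal.coe_add, EReal.coe_le_coe_iff, inner_sub_left]
  linarith

theorem infConv_infPostcomp_mem_Gamma0 (hf : f ∈ Gamma0 H) (hg : g ∈ Gamma0 G)
    (hL : (0 : H) ∈ strongRelInterior
      (ContinuousLinearMap.adjoint L '' effDom (fenchelConj g) - effDom (fenchelConj f))) :
    infConv (infPostcomp L f) g ∈ Gamma0 G := by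
  have hbot := infConv_infPostcomp_ne_bot hf hg hL
  refine ⟨lowerSemicontinuous_iff_isClosed_preimage.2 fun b => ?_, ?_, hbot, ?_⟩
  · induction b with
    | bot => simp [Set.preimage, hbot]
    | top => simp
    | coe a =>
      refine IsSeqClosed.isClosed fun z z₀ hz hlim => ?_
      choose x hx using fun n => (infConv_infPostcomp_le_coe_iff hf hg hL).1 (hz n)
      exact (infConv_infPostcomp_le_coe_iff hf hg hL).2
        (exists_limit_add_le hf hg hL hlim tendsto_const_nhds hx)
  · rintro ⟨z₁, a₁⟩ h₁ ⟨z₂, a₂⟩ h₂ α β hα hβ hαβ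
    obtain ⟨x₁, hx₁⟩ := (infConv_infPostcomp_le_coe_iff hf hg hL).1 h₁
    obtain ⟨x₂, hx₂⟩ := (infConv_infPostcomp_le_coe_iff hf hg hL).1 h₂
    obtain ⟨s₁, t₁, hs₁, ht₁, hst₁⟩ :=
      EReal.exists_real_add_le (hf.2.2.1 _) (hg.2.2.1 _) hx₁
    obtain ⟨s₂, t₂, hs₂, ht₂, hst₂⟩ :=
      EReal.exists_real_add_le (hf.2.2.1 _) (hg.2.2.1 _) hx₂
    have hF : f (α • x₁ + β • x₂) ≤ ((α * s₁ + β * s₂ : ℝ) : EReal) :=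
      hf.2.1 (x := (x₁, s₁)) hs₁.le (y := (x₂, s₂)) hs₂.le hα hβ hαβ
    have hG : g (α • (z₁ - L x₁) + β • (z₂ - L x₂)) ≤ ((α * t₁ + β * t₂ : ℝ) : EReal) :=
      hg.2.1 (x := (z₁ - L x₁, t₁)) ht₁.le (y := (z₂ - L x₂, t₂)) ht₂.le hα hβ hαβ
    refine (infConv_infPostcomp_le_coe_iff hf hg hL).2 ⟨α • x₁ + β • x₂, ?_⟩
    have e : (α • (z₁, a₁) + β • (z₂, a₂)).1 - L (α • x₁ + β • x₂) =
        α • (z₁ - L x₁) + β • (z₂ - L x₂) := by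
      simp only [map_add, map_smul, Prod.fst_add, Prod.smul_fst]
      module
    rw [e]
    refine (add_le_add hF hG).trans ?_
    rw [← EReal.coe_add, EReal.coe_le_coe_iff]
    simp only [Prod.snd_add, Prod.smul_snd, smul_eq_mul]
    nlinarith [mul_le_mul_of_nonneg_left hst₁ hα, mul_le_mul_of_nonneg_left hst₂ hβ]
  · obtain ⟨x, hx⟩ := hf.2.2.2
    obtain ⟨y, hy⟩ := hg.2.2.2
    refine ⟨L x + y, (infConv_infPostcomp_le L f g x _).trans_lt ?_⟩
    rw [add_sub_cancel_left]
    exact EReal.add_lt_top hx.ne hy.ne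

end InfimalConvolution

/-! ### The subdifferential formula -/

theorem lemma2p5 {H G : Type*}
    [NormedAddCommGroup H] [InnerProductSpace ℝ H] [CompleteSpace H]
    [NormedAddCommGroup G] [InnerProductSpace ℝ G] [CompleteSpace G]
    (f : H → EReal) (hf : f ∈ Gamma0 H) (g : G → EReal) (hg : g ∈ Gamma0 G) (L : H →L[ℝ] G)
    (hL : (0 : H) ∈ strongRelInterior
      (ContinuousLinearMap.adjoint L '' effDom (fenchelConj g) - effDom (fenchelConj f))) :
    infConv (infPostcomp L f) g ∈ Gamma0 G ∧
      subdiff (infConv (infPostcomp L f) g) = parallelSum (parallelComp L (subdiff f)) (subdiff g) := by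
  have hmem := infConv_infPostcomp_mem_Gamma0 hf hg hL
  refine ⟨hmem, ?_⟩
  ext z u
  constructor
  · intro hu
    obtain ⟨a, ha⟩ := exists_eq_coe_of_mem_subdiff hmem.2.2.1 hmem.2.2.2 hu
    obtain ⟨x, hx⟩ := (infConv_infPostcomp_le_coe_iff hf hg hL).1 ha.le
    obtain ⟨s, t, hs, ht, hst⟩ := EReal.exists_real_add_le (hf.2.2.1 _) (hg.2.2.1 _) hx
    rw [mem_subdiff_iff_of_eq_coe ha] at hu
    have ha' : a = s + t := by
      refine le_antisymm ?_ hst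
      have := infConv_infPostcomp_le L f g x z
      rw [ha, hs, ht, ← EReal.coe_add, EReal.coe_le_coe_iff] at this
      exact this
    refine ⟨L x, ⟨x, ?_, rfl⟩, z - L x, ?_, add_sub_cancel _ _⟩
    · refine (mem_subdiff_iff_of_eq_coe hs).2 fun x' r hr => ?_
      -- The test point moves only the argument of `f`, keeping that of `g` at `z - L x`.
      have h := hu (L x' + (z - L x)) (r + t) ((infConv_infPostcomp_le L f g x' _).trans (by
        rw [add_sub_cancel_left, ht, EReal.coe_add]
        exact add_le_add_left hr _))
      rw [ContinuousLinearMap.adjoint_inner_right, map_sub]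
      rw [show L x' + (z - L x) - z = L x' - L x by abel] at h
      linarith
    · refine (mem_subdiff_iff_of_eq_coe ht).2 fun y r hr => ?_
      have h := hu (L x + y) (s + r) ((infConv_infPostcomp_le L f g x _).trans (by
        rw [add_sub_cancel_left, hs, EReal.coe_add]
        exact add_le_add_right hr _))
      rw [show L x + y - z = y - (z - L x) by abel] at h
      linarith
  · rintro ⟨_, ⟨x, hx, rfl⟩, y, hy, rfl⟩
    change ContinuousLinearMap.adjoint L u ∈ subdiff f x at hx
    change u ∈ subdiff g y at hy
    obtain ⟨s, hs⟩ := exists_eq_coe_of_mem_subdiff hf.2.2.1 hf.2.2.2 hx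
    obtain ⟨t, ht⟩ := exists_eq_coe_of_mem_subdiff hg.2.2.1 hg.2.2.2 hy
    rw [mem_subdiff_iff_of_eq_coe hs] at hx
    rw [mem_subdiff_iff_of_eq_coe ht] at hy
    -- Adding the subgradient inequalities at a minimizer for `z`. The case `z = L x + y` also shows
    -- that the convolution equals `s + t` there.
    have hbound : ∀ (z : G) (r : ℝ), infConv (infPostcomp L f) g z ≤ r →
        inner ℝ (z - (L x + y)) u + (s + t) ≤ r := by
      intro z r hr
      obtain ⟨x', hx'⟩ := (infConv_infPostcomp_le_coe_iff hf hg hL).1 hr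
      obtain ⟨s', t', hs', ht', hst⟩ := EReal.exists_real_add_le (hf.2.2.1 _) (hg.2.2.1 _) hx'
      have h1 := hx x' s' hs'.le
      have h2 := hy (z - L x') t' ht'.le
      rw [ContinuousLinearMap.adjoint_inner_right, map_sub] at h1
      rw [show z - (L x + y) = (L x' - L x) + (z - L x' - y) by abel, inner_add_left]
      linarith
    have hle : infConv (infPostcomp L f) g (L x + y) ≤ ((s + t : ℝ) : EReal) := by
      have := infConv_infPostcomp_le L f g x (L x + y)
      rwa [add_sub_cancel_left, hs, ht, ← EReal.coe_add] at this
    have heq : infConv (infPostcomp L f) g (L x + y) = ((s + t : ℝ) : EReal) := by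
      refine le_antisymm hle (le_of_forall_gt fun c hc => ?_)
      obtain ⟨r, hr, hrc⟩ := EReal.lt_iff_exists_real_btwn.1 hc
      have := hbound _ r hr.le
      rw [sub_self, inner_zero_left, zero_add] at this
      exact lt_of_le_of_lt (EReal.coe_le_coe_iff.2 this) hrc
    exact (mem_subdiff_iff_of_eq_coe heq).2 hbound
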